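/- **Theorem 1.2.** For $n\ge 1$ let $NC(n)$ be the set of non-crossing partitions of $\{1,\dots,n\}$, i.e. partitions without two distinct blocks $V,W$ and $a<b<c<d$ such that $a,c\in V$ and $b,d\in W$. For $\pi\in NC(n)$ let $P_\pi$ be the permutation of $\{1,\dots,n\}$ performing on each block $\{i_1<\dots<i_k\}$ of $\pi$ the cycle $i_1\mapsto i_2\mapsto\cdots\mapsto i_k\mapsto i_1$. The meandric system (on $2n$ bridges) of a pair $(\pi,\rho)\in NC(n)^2$ is the permutation $M_{\pi,\rho}$ of $\{1,\dots,2n\}$ given by $$M_{\pi,\rho}(2i-1)=2P_\pi^{-1}(i),\qquad M_{\pi,\rho}(2i)=2P_\rho(i)-1\qquad(1\le i\le n).$$ It is irreducible if no non-empty interval $\{a,a+1,\dots,b\}\subsetneq\{1,\dots,2n\}$ is invariant under $M_{\pi,\rho}$. Let $\underline m^{(irr)}_n$ be the number of pairs $(\pi,\rho)\in NC(n)^2$ for which $M_{\pi,\rho}$ is irreducible. For a real random variable $\zeta$ with finite moments of all orders, the free cumulants $(\kappa_n(\zeta))_{n\ge1}$ are the complex numbers uniquely determined by $$\mathbb E[\zeta^n]=\sum_{\pi\in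 NC(n)}\ \prod_{V\in\pi}\kappa_{|V|}(\zeta)\qquad(n\ge1),$$ and the $R$-transform of $\zeta$ is the formal power series $R_\zeta(z)=\sum_{n\ge1}\kappa_n(\zeta)z^n$. Let $\xi,\eta$ be (classically) independent real random variables on a probability space, with finite moments of all orders, each of them centred semicircular of variance $1$, i.e. $$\mathbb E[\xi^n]=\mathbb E[\eta^n]=\frac1{2\pi}\int_{-2}^{2}t^n\sqrt{4-t^2}\,dt\qquad\text{for all } n\ge0.$$ Then $\xi\eta$ has finite moments of all orders, and for every $n\ge1$ $$\kappa_{2n-1}(\xi\eta)=0,\qquad \kappa_{2n}(\xi\eta)=\underline m^{(irr)}_n .$$ Equivalently, the $R$-transform of $\xi\eta$ is the formal power series $f_{\mathrm{irr}}(z)=\sum_{n=1}^{\infty}\underline m^{(irr)}_n z^{2n}$. -/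

import Mathlib

open MeasureTheory ProbabilityTheory

namespace Meandric

/-! ### Non-crossing partitions -/

/-- A partition of the linearly ordered set `Fin n` is non-crossing when there are no two distinct
blocks `V`, `W` and elements `a < b < c < d` with `a, c ∈ V` and `b, d ∈ W`. -/
def IsNonCrossing {n : ℕ} (π : Finpartition (Finset.univ : Finset (Fin n))) : Prop :=
  ∀ V ∈ π.parts, ∀ W ∈ π.parts, V ≠ W →
    ¬ ∃ a b c d : Fin n, a < b ∧ b < c ∧ c < d ∧ a ∈ V ∧ c ∈ V ∧ b ∈ W ∧ d ∈ W

/-- `NC n` is the set of non-crossing partitions of an `n`-element linearly ordered set. -/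
def NC (n : ℕ) : Type :=
  {π : Finpartition (Finset.univ : Finset (Fin n)) // IsNonCrossing π}

noncomputable instance (n : ℕ) : Fintype (NC n) := by
  classical
  exact inferInstanceAs
    (Fintype {π : Finpartition (Finset.univ : Finset (Fin n)) // IsNonCrossing π})

/-- The finite set of blocks of a non-crossing partition. -/
def NC.blocks {n : ℕ} (π : NC n) : Finset (Finset (Fin n)) := π.1.parts

/-! ### The permutation of a partition and meandric systems -/

/-- The increasing cycle `i₁ ↦ i₂ ↦ ⋯ ↦ i_k ↦ i₁` on a set `V = {i₁ < i₂ < ⋯ < i_k}`,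
all other points being fixed. -/
def increasingCycle {n : ℕ} (V : Finset (Fin n)) : Equiv.Perm (Fin n) :=
  (V.sort (· ≤ ·)).formPerm

theorem increasingCycle_mem {n : ℕ} {V : Finset (Fin n)} {i : Fin n} (hi : i ∈ V) :
    increasingCycle V i ∈ V := by
  have := List.formPerm_apply_mem_of_mem (l := V.sort (· ≤ ·)) (x := i)
    ((Finset.mem_sort _).2 hi)
  exact (Finset.mem_sort _).1 this

theorem increasingCycle_symm_mem {n : ℕ} {V : Finset (Fin n)} {i : Fin n} (hi : i ∈ V) :
    (increasingCycle V).symm i ∈ V := by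
  by_contra h
  have h1 : increasingCycle V ((increasingCycle V).symm i) = (increasingCycle V).symm i :=
    List.formPerm_apply_of_notMem (fun hm => h ((Finset.mem_sort _).1 hm))
  rw [Equiv.apply_symm_apply] at h1
  exact h (h1 ▸ hi)

/-- The permutation `P_π` attached to a partition `π`: it performs an increasing cycle on every
block of `π`. -/
def blockPerm {n : ℕ} (π : NC n) : Equiv.Perm (Fin n) where
  toFun i := increasingCycle (π.1.part i) i
  invFun i := (increasingCycle (π.1.part i)).symm i
  left_inv i := by
    have hi : i ∈ π.1.part i := π.1.mem_part (Finset.mem_univ i)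
    have h : π.1.part (increasingCycle (π.1.part i) i) = π.1.part i :=
      π.1.part_eq_of_mem (π.1.part_mem.2 (Finset.mem_univ i)) (increasingCycle_mem hi)
    simp only [h, Equiv.symm_apply_apply]
  right_inv i := by
    have hi : i ∈ π.1.part i := π.1.mem_part (Finset.mem_univ i)
    have h : π.1.part ((increasingCycle (π.1.part i)).symm i) = π.1.part i :=
      π.1.part_eq_of_mem (π.1.part_mem.2 (Finset.mem_univ i)) (increasingCycle_symm_mem hi)
    simp only [h, Equiv.apply_symm_apply]

/-- With points numbered from `0`, the point `i` of `Fin n` is doubled into the two points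
`2 * i` (called `2i - 1` when one counts from `1`) and `2 * i + 1` (called `2i`). -/
def leftPt {n : ℕ} (i : Fin n) : Fin (2 * n) := ⟨2 * i, by omega⟩

/-- The right one of the two points into which `i` is doubled. -/
def rightPt {n : ℕ} (i : Fin n) : Fin (2 * n) := ⟨2 * i + 1, by omega⟩

/-- The point of `Fin n` that was doubled to give `k`. -/
def halfPt {n : ℕ} (k : Fin (2 * n)) : Fin n := ⟨k / 2, by omega⟩

/-- The meandric system of `(π, ρ)` as a map. A left point goes to its partner in the arch-diagram
obtained by doubling `π`, a right point goes to its partner in the arch-diagram obtained by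
doubling `ρ`. -/
def meandricMap {n : ℕ} (π ρ : NC n) (k : Fin (2 * n)) : Fin (2 * n) :=
  if (k : ℕ) % 2 = 0 then rightPt ((blockPerm π).symm (halfPt k)) else leftPt (blockPerm ρ (halfPt k))

theorem meandricMap_leftPt {n : ℕ} (π ρ : NC n) (i : Fin n) :
    meandricMap π ρ (leftPt i) = rightPt ((blockPerm π).symm i) := by
  have h : halfPt (leftPt i) = i := by ext; simp [halfPt, leftPt]
  simp [meandricMap, h]
  simp [leftPt]

theorem meandricMap_rightPt {n : ℕ} (π ρ : NC n) (i : Fin n) :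
    meandricMap π ρ (rightPt i) = leftPt (blockPerm ρ i) := by
  have h : halfPt (rightPt i) = i := by ext; simp [halfPt, rightPt]; omega
  have h2 : ((rightPt i : Fin (2 * n)) : ℕ) % 2 ≠ 0 := by simp [rightPt]
  simp only [meandricMap, if_neg h2, h]

theorem meandricMap_comp {n : ℕ} (π ρ : NC n) (k : Fin (2 * n)) :
    meandricMap ρ π (meandricMap π ρ k) = k := by
  rcases Nat.mod_two_eq_zero_or_one (k : ℕ) with hk | hk
  · have h : k = leftPt (halfPt k) := by ext; simp [halfPt, leftPt]; omega
    rw [h, meandricMap_leftPt, meandricMap_rightPt, Equiv.apply_symm_apply]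
  · have h : k = rightPt (halfPt k) := by ext; simp [halfPt, rightPt]; omega
    rw [h, meandricMap_rightPt, meandricMap_leftPt, Equiv.symm_apply_apply]

/-- The meandric system on `2n` bridges associated to `π, ρ ∈ NC(n)`: the permutation
`M_{π,ρ}` of `2n` points with `M (2i - 1) = 2 P_π⁻¹ (i)` and `M (2i) = 2 P_ρ (i) - 1` (points
counted from `1`). -/
def meandricSystem {n : ℕ} (π ρ : NC n) : Equiv.Perm (Fin (2 * n)) where
  toFun := meandricMap π ρ
  invFun := meandricMap ρ π
  left_inv := meandricMap_comp π ρ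
  right_inv := meandricMap_comp ρ π

/-- A permutation of `Fin m` is reducible when some proper non-empty subinterval `{a, …, b}` is
invariant under it. -/
def IsReducible {m : ℕ} (M : Equiv.Perm (Fin m)) : Prop :=
  ∃ a b : Fin m, a ≤ b ∧ Set.Icc a b ≠ Set.univ ∧ Set.MapsTo M (Set.Icc a b) (Set.Icc a b)

/-- `M` is irreducible when it is not reducible. -/
def IsIrreducible {m : ℕ} (M : Equiv.Perm (Fin m)) : Prop := ¬ IsReducible M

/-- The number of irreducible meandric systems on `2n` bridges, that is, of pairs
`(π, ρ) ∈ NC(n)²` such that `M_{π,ρ}` is irreducible. -/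
noncomputable def numIrreducible (n : ℕ) : ℕ :=
  Nat.card {p : NC n × NC n // IsIrreducible (meandricSystem p.1 p.2)}

/-- The even generating function `∑_{n ≥ 1} m_n z^{2n}` of the numbers `m_n` of irreducible
meandric systems on `2n` bridges. -/
noncomputable def irreducibleSeries : PowerSeries ℂ :=
  PowerSeries.mk fun k => if Even k ∧ k ≠ 0 then (numIrreducible (k / 2) : ℂ) else 0

/-! ### Free cumulants and the R-transform -/

/-- The free cumulants `κ_n(μ)`, `n ≥ 1`, of a linear functional `μ` on `ℂ[X]` with `μ 1 = 1`: the
moment-cumulant formula `μ (X ^ n) = ∑_{π ∈ NC(n)} ∏_{V ∈ π} κ_{|V|}(μ)`, solved for the term of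
the one-block partition. The sum below runs over the other partitions, those whose blocks all have
fewer than `n` elements. That the formula holds and determines the cumulants is
`moment_eq_sum_freeCumulant` and `eq_freeCumulant`. -/
noncomputable def freeCumulant (μ : Polynomial ℂ →ₗ[ℂ] ℂ) (n : ℕ) : ℂ :=
  open Classical in
  μ (Polynomial.X ^ n) -
    ∑ π : {π : NC n // ∀ V ∈ π.blocks, V.card < n},
      ∏ V : {V : Finset (Fin n) // V ∈ π.1.blocks}, freeCumulant μ V.1.card
termination_by n
decreasing_by exact π.2 V.1 V.2

/-- The one-block partition. -/
def NC.one {n : ℕ} (hn : 1 ≤ n) : NC n :=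
  ⟨Finpartition.indiscrete (a := (Finset.univ : Finset (Fin n)))
      (Finset.nonempty_iff_ne_empty.1 ⟨⟨0, hn⟩, Finset.mem_univ _⟩), by
    intro V hV W hW h
    simp only [Finpartition.indiscrete_parts, Finset.mem_singleton] at hV hW
    exact absurd (hV.trans hW.symm) h⟩

theorem NC.eq_one_iff {n : ℕ} (hn : 1 ≤ n) (π : NC n) :
    ¬ (∀ V ∈ π.blocks, V.card < n) ↔ π = NC.one hn := by
  constructor
  · intro h
    push Not at h
    obtain ⟨V, hV, hc⟩ := h
    have hVu : V = Finset.univ := by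
      rw [← Finset.card_eq_iff_eq_univ, Fintype.card_fin]
      exact le_antisymm (by simpa using Finset.card_le_univ V) hc
    apply Subtype.ext
    apply Finpartition.ext
    ext W
    simp only [NC.one, Finpartition.indiscrete_parts, Finset.mem_singleton]
    constructor
    · intro hW
      obtain ⟨x, hx⟩ := π.1.nonempty_of_mem_parts hW
      rw [← hVu]
      exact π.1.eq_of_mem_parts hW hV hx (hVu ▸ Finset.mem_univ x)
    · rintro rfl
      exact hVu ▸ hV
  · rintro rfl h
    have := h Finset.univ (by simp [NC.one, NC.blocks])
    simp at this

theorem NC.sum_eq {n : ℕ} (hn : 1 ≤ n) (c : ℕ → ℂ) :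
    open Classical in
    ∑ π : NC n, ∏ V ∈ π.blocks, c V.card =
      c n + ∑ π : {π : NC n // ∀ V ∈ π.blocks, V.card < n},
        ∏ V : {V : Finset (Fin n) // V ∈ π.1.blocks}, c V.1.card := by
  classical
  rw [← Finset.sum_filter_not_add_sum_filter Finset.univ (fun π : NC n => ∀ V ∈ π.blocks, V.card < n)]
  congr 1
  · rw [Finset.sum_congr (s₂ := {NC.one hn}) (by ext π; simp [← NC.eq_one_iff hn])
      (fun _ _ => rfl), Finset.sum_singleton]
    simp [NC.one, NC.blocks]
  · rw [← Finset.sum_subtype_eq_sum_filter, Finset.subtype_univ]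
    refine Finset.sum_congr (by ext; simp) fun π _ => ?_
    exact (Finset.prod_coe_sort π.1.blocks (fun V => c V.card)).symm

/-- The moment-cumulant formula. -/
theorem moment_eq_sum_freeCumulant (μ : Polynomial ℂ →ₗ[ℂ] ℂ) {n : ℕ} (hn : 1 ≤ n) :
    μ (Polynomial.X ^ n) = ∑ π : NC n, ∏ V ∈ π.blocks, freeCumulant μ V.card := by
  rw [NC.sum_eq hn, freeCumulant]
  ring

/-- The moment-cumulant formula determines the free cumulants. -/
theorem eq_freeCumulant (μ : Polynomial ℂ →ₗ[ℂ] ℂ) (c : ℕ → ℂ)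
    (h : ∀ n, 1 ≤ n → μ (Polynomial.X ^ n) = ∑ π : NC n, ∏ V ∈ π.blocks, c V.card) :
    ∀ n, 1 ≤ n → c n = freeCumulant μ n := by
  intro n
  induction n using Nat.strong_induction_on with
  | _ n ih =>
    intro hn
    have h1 := h n hn
    rw [NC.sum_eq hn] at h1
    rw [freeCumulant, h1, eq_comm, sub_eq_iff_eq_add, add_right_inj]
    refine Finset.sum_congr rfl fun π _ => Finset.prod_congr rfl fun V _ => ?_
    exact ih _ (π.2 V.1 V.2) (Finset.card_pos.2 (π.1.1.nonempty_of_mem_parts V.2))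

/-- The R-transform `R_μ(z) = ∑_{n ≥ 1} κ_n(μ) z^n`, a formal power series. -/
noncomputable def rTransform (μ : Polynomial ℂ →ₗ[ℂ] ℂ) : PowerSeries ℂ :=
  PowerSeries.mk fun n => if n = 0 then 0 else freeCumulant μ n

/-! ### Random variables -/

/-- The distribution of a real random variable with finite moments of all orders: the linear
functional on `ℂ[X]` with `μ (X ^ n) = ∫ ξ ^ n dP` for all `n`. -/
noncomputable def distribution {Ω : Type*} [MeasurableSpace Ω] (P : Measure Ω) (ξ : Ω → ℝ) :
    Polynomial ℂ →ₗ[ℂ] ℂ :=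
  (Polynomial.basisMonomials ℂ).constr ℂ fun n => ((∫ ω, ξ ω ^ n ∂P : ℝ) : ℂ)

theorem distribution_X_pow {Ω : Type*} [MeasurableSpace Ω] (P : Measure Ω) (ξ : Ω → ℝ) (n : ℕ) :
    distribution P ξ (Polynomial.X ^ n) = ((∫ ω, ξ ω ^ n ∂P : ℝ) : ℂ) := by
  have h := (Polynomial.basisMonomials ℂ).constr_basis ℂ
    (fun n => ((∫ ω, ξ ω ^ n ∂P : ℝ) : ℂ)) n
  rw [Polynomial.X_pow_eq_monomial]
  simpa only [distribution, Polynomial.coe_basisMonomials] using h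

/-- `ξ` is a random variable with finite moments of all orders whose distribution, as a functional
on polynomials, is the semicircle law `(2π)⁻¹ √(4 - t²) dt` on `[-2, 2]`. -/
structure IsCentredSemicircular {Ω : Type*} [MeasurableSpace Ω] (P : Measure Ω) (ξ : Ω → ℝ) :
    Prop where
  measurable : Measurable ξ
  integrable_pow : ∀ n : ℕ, Integrable (fun ω => ξ ω ^ n) P
  moment : ∀ n : ℕ, ∫ ω, ξ ω ^ n ∂P =
    (2 * Real.pi)⁻¹ * ∫ t in (-2 : ℝ)..2, t ^ n * √(4 - t ^ 2)

end Meandric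

/-! A left point and a right point are exchanged by the involution `meandricMap π π`, which draws the
arch diagram of `π`: a non-crossing pairing of `2n` points. Every non-crossing pairing arises exactly
once in this way (`archDiagram_injective`, `archDiagram_surjective`), and an interval is stable
under `meandricSystem π ρ` exactly when it is stable under both arch diagrams. So `numIrreducible n`
counts the pairs of non-crossing pairings of `2n` points that stabilise no proper non-empty interval
(`numIrreducible_eq`).

An arbitrary pair of non-crossing pairings of `n` points preserves a finest non-crossing partition,
and it restricts to an irreducible pair on each block. Conversely, irreducible pairs on the blocks of
a non-crossing partition glue to a pair of non-crossing pairings, and the partition can be recovered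
from the result: a non-crossing partition with at least two classes has a class that is a proper
interval, so an irreducible pair preserves no such partition. Hence the number of pairs satisfies
the moment-cumulant formula, with the numbers of irreducible pairs as cumulants
(`card_ncPairing_sq`).

The number of non-crossing pairings of `n` points is the `n`-th moment of the semicircle law: both
are Catalan numbers for even `n` and vanish for odd `n`. By independence the `n`-th moment of `ξ η`
is its square, which is the number of pairs, and the moment-cumulant formula determines the free
cumulants.
-/

namespace Meandric

/-! ### Non-crossing pairings -/

/-- A non-crossing pairing (arch diagram) of a linear order, encoded as the fixed-point-free
involution exchanging the two ends of every arch. It is enough to forbid a crossing of the form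
`a < b < f a < f b`, since every crossing takes this form with `a` and `b` the left ends. -/
@[ext]
structure NCPairing (α : Type*) [LinearOrder α] where
  /-- The partner of a point. -/
  toFun : α → α
  apply_apply : ∀ x, toFun (toFun x) = x
  apply_ne : ∀ x, toFun x ≠ x
  not_crossing : ∀ a b, a < b → b < toFun a → toFun a < toFun b → False

namespace NCPairing

variable {α β : Type*} [LinearOrder α] [LinearOrder β]

instance : CoeFun (NCPairing α) (fun _ => α → α) := ⟨toFun⟩

theorem coe_injective : Function.Injective (fun f : NCPairing α => (f : α → α)) :=
  fun _ _ h => NCPairing.ext h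

instance [Finite α] : Finite (NCPairing α) := Finite.of_injective _ coe_injective

theorem apply_mem_iff (f : NCPairing α) {s : α → Prop} (h : ∀ x, s x → s (f x)) (x : α) :
    s (f x) ↔ s x :=
  ⟨fun hx => f.apply_apply x ▸ h _ hx, h x⟩

/-- A point under an arch has its partner under the same arch. -/
theorem lt_apply_of_lt (f : NCPairing α) {a x : α} (h1 : a < x) (h2 : x < f a) :
    a < f x ∧ f x < f a := by
  constructor
  · by_contra! h
    rcases h.lt_or_eq with h | h
    · refine f.not_crossing (f x) a h ?_ ?_ <;> rw [f.apply_apply] <;> assumption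
    · rw [← h, f.apply_apply] at h2
      exact lt_irrefl _ h2
  · by_contra! h
    rcases h.lt_or_eq with h | h
    · exact f.not_crossing a x h1 h2 h
    · have := congrArg f h
      rw [f.apply_apply, f.apply_apply] at this
      exact h1.ne this

/-- Transport of a pairing along an order isomorphism. -/
def map (e : α ≃o β) (f : NCPairing α) : NCPairing β where
  toFun x := e (f (e.symm x))
  apply_apply x := by simp [f.apply_apply]
  apply_ne x h := f.apply_ne (e.symm x) (e.injective (h.trans (e.apply_symm_apply x).symm))
  not_crossing a b h1 h2 h3 := by
    refine f.not_crossing (e.symm a) (e.symm b) (by simpa using h1) ?_ (by simpa using h3)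
    simpa using e.symm.lt_iff_lt.2 h2

@[simp]
theorem map_apply (e : α ≃o β) (f : NCPairing α) (x : β) : f.map e x = e (f (e.symm x)) := rfl

/-- Order isomorphic orders have the same pairings. -/
def congr (e : α ≃o β) : NCPairing α ≃ NCPairing β where
  toFun := map e
  invFun := map e.symm
  left_inv f := by ext x; simp
  right_inv f := by ext x; simp

theorem even_card [Finite α] (f : NCPairing α) : Even (Nat.card α) := by
  classical
  have := Fintype.ofFinite α
  let g : Function.End α := f.toFun
  have hg : g ^ 2 ^ 1 = 1 := by
    funext x
    rw [pow_one, pow_two]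
    exact f.apply_apply x
  have h := Equiv.Perm.card_fixedPoints_modEq (f := g) (p := 2) (n := 1) hg
  have h0 : IsEmpty (Function.fixedPoints g) := ⟨fun x => f.apply_ne x.1 x.2⟩
  rw [Fintype.card_eq_zero_iff.2 h0] at h
  rw [Nat.card_eq_fintype_card]
  exact (Nat.even_iff).2 h

end NCPairing

/-! ### Irreducible pairs of pairings -/

section Irreducible

variable {α β : Type*} [LinearOrder α] [LinearOrder β]

/-- The only non-empty interval that is stable under both `f` and `g` is the whole order. -/
def IsIrreduciblePair (p : NCPairing α × NCPairing α) : Prop :=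
  ∀ a b : α, a ≤ b → Set.MapsTo p.1 (Set.Icc a b) (Set.Icc a b) →
    Set.MapsTo p.2 (Set.Icc a b) (Set.Icc a b) → Set.Icc a b = Set.univ

variable (α) in
/-- The irreducible pairs of non-crossing pairings of a linear order. -/
abbrev IrrPair : Type _ := {p : NCPairing α × NCPairing α // IsIrreduciblePair p}

theorem IsIrreduciblePair.map {p : NCPairing α × NCPairing α} (hp : IsIrreduciblePair p)
    (e : α ≃o β) : IsIrreduciblePair (p.1.map e, p.2.map e) := by
  intro a b hab h1 h2
  have key (f : NCPairing α) (h : Set.MapsTo (f.map e) (Set.Icc a b) (Set.Icc a b)) :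
      Set.MapsTo f (Set.Icc (e.symm a) (e.symm b)) (Set.Icc (e.symm a) (e.symm b)) := by
    intro x hx
    have := @h (e x) (by simpa [e.symm_apply_le, e.le_symm_apply] using hx)
    simpa [e.symm_apply_le, e.le_symm_apply] using this
  have := hp (e.symm a) (e.symm b) (by simpa using hab) (key _ h1) (key _ h2)
  ext x
  have hx := Set.ext_iff.1 this (e.symm x)
  simpa using hx

theorem card_irrPair_congr (e : α ≃o β) : Nat.card (IrrPair α) = Nat.card (IrrPair β) :=
  Nat.card_congr
    { toFun := fun p => ⟨_, p.2.map e⟩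
      invFun := fun p => ⟨_, p.2.map e.symm⟩
      left_inv := fun p => by
        apply Subtype.ext
        exact Prod.ext ((NCPairing.congr e).left_inv _) ((NCPairing.congr e).left_inv _)
      right_inv := fun p => by
        apply Subtype.ext
        exact Prod.ext ((NCPairing.congr e).right_inv _) ((NCPairing.congr e).right_inv _) }

/-- A relation without crossing classes. -/
def NonCrossingRel (r : α → α → Prop) : Prop :=
  ∀ a b c d, a < b → b < c → c < d → r a c → r b d → r a b

/-- An irreducible pair preserves no non-crossing partition with more than one class. Indeed the
class whose largest element is smallest is an interval. -/
theorem IsIrreduciblePair.rel_of_preserves [Finite α] {p : NCPairing α × NCPairing α}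
    (hp : IsIrreduciblePair p) (r : Setoid α) (hr : NonCrossingRel r)
    (h1 : ∀ x, r (p.1 x) x) (h2 : ∀ x, r (p.2 x) x) (x y : α) : r x y := by
  have hfin : ∀ x, {z | r x z}.Finite := fun x => Set.toFinite _
  -- `T` holds the largest elements of the classes
  let T : Set α := {b | ∀ z, r b z → z ≤ b}
  have hmax : ∀ x, ∃ M ∈ T, r x M := by
    intro x
    obtain ⟨M, hM, hM'⟩ := Set.exists_max_image {z | r x z} id (hfin x) ⟨x, r.refl x⟩
    exact ⟨M, fun z hz => hM' z (r.trans hM hz), hM⟩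
  obtain ⟨b, hbT, hb⟩ := Set.exists_min_image T id (Set.toFinite T)
    (let ⟨M, hM, _⟩ := hmax x; ⟨M, hM⟩)
  obtain ⟨a, hba, ha⟩ := Set.exists_min_image {z | r b z} id (hfin b) ⟨b, r.refl b⟩
  have hcls : ∀ z, z ∈ Set.Icc a b ↔ r b z := by
    intro z
    refine ⟨fun hz => ?_, fun hz => ⟨ha z hz, hbT z hz⟩⟩
    by_contra hbz
    obtain ⟨M, hM, hzM⟩ := hmax z
    have hbM : b < M := by
      refine lt_of_le_of_ne (hb M hM) ?_
      rintro rfl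
      exact hbz (r.symm hzM)
    have haz : a < z := lt_of_le_of_ne hz.1 (by rintro rfl; exact hbz hba)
    have hzb : z < b := lt_of_le_of_ne hz.2 (by rintro rfl; exact hbz (r.refl _))
    exact hbz (r.trans hba (hr a z b M haz hzb hbM (r.symm hba) hzM))
  have huniv := hp a b (hbT a hba)
    (fun z hz => (hcls _).2 (r.trans ((hcls z).1 hz) (r.symm (h1 z))))
    (fun z hz => (hcls _).2 (r.trans ((hcls z).1 hz) (r.symm (h2 z))))
  have hall : ∀ z, r b z := fun z => (hcls z).1 (huniv ▸ Set.mem_univ z)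
  exact r.trans (r.symm (hall x)) (hall y)

end Irreducible

/-! ### Gluing pairings along a non-crossing family of fibres -/

namespace NCPairing

variable {α : Type*} [LinearOrder α] {ι : Type*} (q : α → ι)

/-- The pairing that restricts to the given pairings of the fibres of `q`, these fibres being
assumed not to cross one another. -/
def glue (hq : NonCrossingRel fun x y => q x = q y) (F : ∀ i, NCPairing {x // q x = i}) :
    NCPairing α where
  toFun x := (F (q x) ⟨x, rfl⟩).1
  apply_apply x := by
    have key : ∀ (i : ι) (y : {x // q x = i}), (F (q y.1) ⟨y.1, rfl⟩).1 = (F i y).1 := by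
      rintro _ ⟨y, rfl⟩
      rfl
    rw [key, apply_apply]
  apply_ne x h := (F (q x)).apply_ne ⟨x, rfl⟩ (Subtype.ext h)
  not_crossing a b h1 h2 h3 := by
    have key : ∀ (i : ι) (y : {x // q x = i}), (F (q y.1) ⟨y.1, rfl⟩).1 = (F i y).1 := by
      rintro _ ⟨y, rfl⟩
      rfl
    have hab : q a = q b :=
      hq a b _ _ h1 h2 h3 (F (q a) ⟨a, rfl⟩).2.symm (F (q b) ⟨b, rfl⟩).2.symm
    have hb := key (q a) ⟨b, hab.symm⟩
    simp only at hb
    rw [hb] at h3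
    exact (F (q a)).not_crossing ⟨a, rfl⟩ ⟨b, hab.symm⟩ h1 h2 h3

variable {q} {hq : NonCrossingRel fun x y => q x = q y}

theorem glue_apply (F : ∀ i, NCPairing {x // q x = i}) {i : ι} (y : {x // q x = i}) :
    glue q hq F y.1 = (F i y).1 := by
  obtain ⟨y, rfl⟩ := y
  rfl

theorem glue_preserves (F : ∀ i, NCPairing {x // q x = i}) (x : α) : q (glue q hq F x) = q x :=
  (F (q x) ⟨x, rfl⟩).2

theorem glue_injective : Function.Injective (glue q hq) := by
  intro F G h
  funext i
  ext y
  rw [← glue_apply (hq := hq) F y, ← glue_apply (hq := hq) G y, h]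

/-- The restriction to a fibre of `q` of a pairing that preserves the fibres. -/
def restrict (f : NCPairing α) (hf : ∀ x, q (f x) = q x) (i : ι) : NCPairing {x // q x = i} where
  toFun x := ⟨f x.1, (hf x.1).trans x.2⟩
  apply_apply x := Subtype.ext (f.apply_apply x.1)
  apply_ne x h := f.apply_ne x.1 (congrArg Subtype.val h)
  not_crossing a b h1 h2 h3 := f.not_crossing a.1 b.1 h1 h2 h3

variable (q) in
/-- A pairing that preserves the fibres of `q` amounts to a pairing of each fibre. -/
noncomputable def glueEquiv (hq : NonCrossingRel fun x y => q x = q y) :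
    (∀ i, NCPairing {x // q x = i}) ≃ {f : NCPairing α // ∀ x, q (f x) = q x} :=
  Equiv.ofBijective (fun F => ⟨glue q hq F, glue_preserves F⟩)
    ⟨fun _ _ h => glue_injective (hq := hq) (congrArg Subtype.val h),
      fun f => ⟨restrict f.1 f.2, rfl⟩⟩

end NCPairing

/-! ### Decomposition of a pair of pairings into irreducible pairs -/

namespace NC

variable {n : ℕ}

/-- The block of a point, as an element of the type of blocks. -/
def blockOf (π : NC n) (x : Fin n) : {V // V ∈ π.blocks} :=
  ⟨π.1.part x, π.1.part_mem.2 (Finset.mem_univ x)⟩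

theorem mem_part_self (π : NC n) (x : Fin n) : x ∈ π.1.part x :=
  π.1.mem_part (Finset.mem_univ x)

theorem blockOf_eq_iff (π : NC n) {x : Fin n} {V : {V // V ∈ π.blocks}} :
    π.blockOf x = V ↔ x ∈ V.1 :=
  Subtype.ext_iff.trans (π.1.part_eq_iff_mem V.2)

theorem blockOf_eq_blockOf_iff (π : NC n) {x y : Fin n} :
    π.blockOf x = π.blockOf y ↔ x ∈ π.1.part y :=
  π.blockOf_eq_iff

theorem nonCrossingRel (π : NC n) : NonCrossingRel fun x y => π.blockOf x = π.blockOf y := by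
  intro a b c d hab hbc hcd hac hbd
  by_contra h
  exact π.2 _ (π.blockOf a).2 _ (π.blockOf b).2 (fun h' => h (Subtype.ext h'))
    ⟨a, b, c, d, hab, hbc, hcd, π.mem_part_self a, π.blockOf_eq_iff.1 hac.symm,
      π.mem_part_self b, π.blockOf_eq_iff.1 hbd.symm⟩

/-- The non-crossing partition into the classes of an equivalence relation. -/
noncomputable def ofSetoid (r : Setoid (Fin n)) (hr : NonCrossingRel r) : NC n :=
  haveI : DecidableRel r.r := Classical.decRel _
  ⟨Finpartition.ofSetoid r, by
    rintro V hV W hW hVW ⟨a, b, c, d, hab, hbc, hcd, ha, hc, hb, hd⟩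
    have e1 := (Finpartition.ofSetoid r).part_eq_of_mem hV ha
    have e2 := (Finpartition.ofSetoid r).part_eq_of_mem hW hb
    rw [← e1, Finpartition.mem_part_ofSetoid_iff_rel] at hc
    rw [← e2, Finpartition.mem_part_ofSetoid_iff_rel] at hd
    have := Finpartition.mem_part_ofSetoid_iff_rel.2 (hr a b c d hab hbc hcd hc hd)
    rw [e1] at this
    exact hVW ((Finpartition.ofSetoid r).eq_of_mem_parts hV hW this hb)⟩

theorem blockOf_ofSetoid {r : Setoid (Fin n)} {hr : NonCrossingRel r} {x y : Fin n} :
    (ofSetoid r hr).blockOf x = (ofSetoid r hr).blockOf y ↔ r x y := by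
  let _ : DecidableRel r.r := Classical.decRel _
  rw [blockOf_eq_blockOf_iff]
  exact Finpartition.mem_part_ofSetoid_iff_rel.trans ⟨r.symm, r.symm⟩

theorem ext_of_blockOf {π ρ : NC n}
    (h : ∀ x y, π.blockOf x = π.blockOf y ↔ ρ.blockOf x = ρ.blockOf y) : π = ρ := by
  have hpart : ∀ x, π.1.part x = ρ.1.part x := by
    intro x
    ext y
    rw [← blockOf_eq_blockOf_iff, ← blockOf_eq_blockOf_iff, h]
  have hsub : ∀ {π ρ : NC n}, (∀ x, π.1.part x = ρ.1.part x) → π.1.parts ⊆ ρ.1.parts := by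
    intro π ρ h V hV
    obtain ⟨x, hx⟩ := π.1.nonempty_of_mem_parts hV
    rw [← π.1.part_eq_of_mem hV hx, h]
    exact ρ.1.part_mem.2 (Finset.mem_univ x)
  exact Subtype.ext (Finpartition.ext ((hsub hpart).antisymm (hsub fun x => (hpart x).symm)))

/-- A block is order isomorphic to an initial segment of the naturals. -/
noncomputable def fiberIso (π : NC n) (V : {V // V ∈ π.blocks}) :
    {x // π.blockOf x = V} ≃o Fin V.1.card :=
  OrderIso.trans
    { toEquiv := Equiv.subtypeEquivRight fun _ => π.blockOf_eq_iff
      map_rel_iff' := Iff.rfl }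
    (V.1.orderIsoOfFin rfl).symm

end NC

/-- The pair of pairings obtained from an irreducible pair on every block of `π`. -/
noncomputable def gluePair {n : ℕ}
    (x : Σ π : NC n, ∀ V : {V // V ∈ π.blocks}, IrrPair {x // π.blockOf x = V}) :
    NCPairing (Fin n) × NCPairing (Fin n) :=
  (NCPairing.glue x.1.blockOf x.1.nonCrossingRel fun V => (x.2 V).1.1,
    NCPairing.glue x.1.blockOf x.1.nonCrossingRel fun V => (x.2 V).1.2)

/-- The partition underlying `gluePair x` is finer than any other non-crossing partition preserved
by `gluePair x`, because the pair is irreducible on each block. -/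
theorem rel_of_gluePair_preserves {n : ℕ}
    (x : Σ π : NC n, ∀ V : {V // V ∈ π.blocks}, IrrPair {x // π.blockOf x = V})
    (ρ : NC n) (h1 : ∀ i, ρ.blockOf ((gluePair x).1 i) = ρ.blockOf i)
    (h2 : ∀ i, ρ.blockOf ((gluePair x).2 i) = ρ.blockOf i) {i j : Fin n}
    (hij : x.1.blockOf i = x.1.blockOf j) : ρ.blockOf i = ρ.blockOf j := by
  refine (x.2 (x.1.blockOf j)).2.rel_of_preserves
    (Setoid.ker fun y : {y // x.1.blockOf y = x.1.blockOf j} => ρ.blockOf y.1) ?_ ?_ ?_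
    ⟨i, hij⟩ ⟨j, rfl⟩
  · intro a b c d hab hbc hcd hac hbd
    exact ρ.nonCrossingRel a.1 b.1 c.1 d.1 hab hbc hcd hac hbd
  · intro y
    have := h1 y.1
    rw [gluePair, NCPairing.glue_apply (fun V => (x.2 V).1.1) y] at this
    exact this
  · intro y
    have := h2 y.1
    rw [gluePair, NCPairing.glue_apply (fun V => (x.2 V).1.2) y] at this
    exact this

theorem gluePair_injective {n : ℕ} : Function.Injective (gluePair (n := n)) := by
  intro x y h
  have hx (i) := NCPairing.glue_preserves (hq := x.1.nonCrossingRel) (fun V => (x.2 V).1.1) i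
  have hx' (i) := NCPairing.glue_preserves (hq := x.1.nonCrossingRel) (fun V => (x.2 V).1.2) i
  have hy (i) := NCPairing.glue_preserves (hq := y.1.nonCrossingRel) (fun V => (y.2 V).1.1) i
  have hy' (i) := NCPairing.glue_preserves (hq := y.1.nonCrossingRel) (fun V => (y.2 V).1.2) i
  have hxy : x.1 = y.1 := by
    refine NC.ext_of_blockOf fun i j => ⟨fun hij => ?_, fun hij => ?_⟩
    · refine rel_of_gluePair_preserves x y.1 ?_ ?_ hij
      · rw [h]; exact hy
      · rw [h]; exact hy'
    · refine rel_of_gluePair_preserves y x.1 ?_ ?_ hij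
      · rw [← h]; exact hx
      · rw [← h]; exact hx'
  obtain ⟨π, F⟩ := x
  obtain ⟨ρ, G⟩ := y
  obtain rfl : π = ρ := hxy
  have e1 : (fun V => (F V).1.1) = fun V => (G V).1.1 :=
    NCPairing.glue_injective (hq := π.nonCrossingRel) (congrArg Prod.fst h)
  have e2 : (fun V => (F V).1.2) = fun V => (G V).1.2 :=
    NCPairing.glue_injective (hq := π.nonCrossingRel) (congrArg Prod.snd h)
  congr 1
  funext V
  exact Subtype.ext (Prod.ext (congrFun e1 V) (congrFun e2 V))

/-- The finest non-crossing partition preserved by two pairings. -/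
def finestPreserved {α : Type*} [LinearOrder α] (p : NCPairing α × NCPairing α) : Setoid α :=
  sInf {r | NonCrossingRel r ∧ (∀ x, r (p.1 x) x) ∧ ∀ x, r (p.2 x) x}

section finestPreserved

variable {α : Type*} [LinearOrder α] (p : NCPairing α × NCPairing α)

theorem finestPreserved_nonCrossingRel : NonCrossingRel (finestPreserved p) :=
  fun a b c d hab hbc hcd hac hbd r hr =>
    hr.1 a b c d hab hbc hcd (hac r hr) (hbd r hr)

theorem finestPreserved_fst (x : α) : finestPreserved p (p.1 x) x := fun _ hr => hr.2.1 x

theorem finestPreserved_snd (x : α) : finestPreserved p (p.2 x) x := fun _ hr => hr.2.2 x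

/-- A preserved interval `[a, b]` of a class of the finest partition is the whole class, since
splitting it off would give a finer non-crossing partition. -/
theorem mem_Icc_of_finestPreserved {a b : α} (hle : a ≤ b)
    (h1 : ∀ x, finestPreserved p a x → x ∈ Set.Icc a b → p.1 x ∈ Set.Icc a b)
    (h2 : ∀ x, finestPreserved p a x → x ∈ Set.Icc a b → p.2 x ∈ Set.Icc a b)
    {y : α} (hy : finestPreserved p a y) : y ∈ Set.Icc a b := by
  set r := finestPreserved p with hr
  have hnc := finestPreserved_nonCrossingRel p
  rw [← hr] at hnc
  let J : Set α := {x | r a x ∧ x ∈ Set.Icc a b}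
  let s : Setoid α := r ⊓ Setoid.ker fun x => x ∈ J
  have hs : s ∈ {r : Setoid α | NonCrossingRel r ∧ (∀ x, r (p.1 x) x) ∧ ∀ x, r (p.2 x) x} := by
    refine ⟨?_, fun x => ⟨finestPreserved_fst p x, ?_⟩, fun x => ⟨finestPreserved_snd p x, ?_⟩⟩
    · rintro c d e f hcd hde hef ⟨hce, hce'⟩ ⟨hdf, hdf'⟩
      have hcdr := hnc c d e f hcd hde hef hce hdf
      refine ⟨hcdr, propext ⟨fun hc => ?_, fun hd => ?_⟩⟩
      · have he : e ∈ J := (iff_of_eq hce').1 hc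
        exact ⟨r.trans hc.1 hcdr, hc.2.1.trans hcd.le, hde.le.trans he.2.2⟩
      · have hf : f ∈ J := (iff_of_eq hdf').1 hd
        refine (iff_of_eq hce').2 ⟨r.trans hd.1 (r.trans (r.symm hcdr) hce), ?_⟩
        exact ⟨hd.2.1.trans hde.le, hef.le.trans hf.2.2⟩
    · exact propext (p.1.apply_mem_iff (s := (· ∈ J))
        (fun z hz => ⟨r.trans hz.1 (r.symm (finestPreserved_fst p z)), h1 z hz.1 hz.2⟩) x)
    · exact propext (p.2.apply_mem_iff (s := (· ∈ J))
        (fun z hz => ⟨r.trans hz.1 (r.symm (finestPreserved_snd p z)), h2 z hz.1 hz.2⟩) x)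
  have hay : s a y := hy s hs
  exact ((iff_of_eq hay.2).1 ⟨r.refl a, le_rfl, hle⟩).2

end finestPreserved

theorem gluePair_surjective {n : ℕ} : Function.Surjective (gluePair (n := n)) := by
  intro p
  let π := NC.ofSetoid (finestPreserved p) (finestPreserved_nonCrossingRel p)
  have h1 (x) : π.blockOf (p.1 x) = π.blockOf x :=
    NC.blockOf_ofSetoid.2 (finestPreserved_fst p x)
  have h2 (x) : π.blockOf (p.2 x) = π.blockOf x :=
    NC.blockOf_ofSetoid.2 (finestPreserved_snd p x)
  refine ⟨⟨π, fun V => ⟨(p.1.restrict h1 V, p.2.restrict h2 V), ?_⟩⟩, rfl⟩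
  intro a b hab ha hb
  have hV {x y : {x // π.blockOf x = V}} : finestPreserved p x.1 y.1 :=
    NC.blockOf_ofSetoid.1 (x.2.trans y.2.symm)
  have hV' {x : Fin n} (h : finestPreserved p a.1 x) : π.blockOf x = V :=
    (NC.blockOf_ofSetoid.2 h).symm.trans a.2
  refine Set.eq_univ_of_forall fun y => ?_
  exact mem_Icc_of_finestPreserved p hab
    (fun x hx hx' => @ha ⟨x, hV' hx⟩ hx') (fun x hx hx' => @hb ⟨x, hV' hx⟩ hx')
    (hV (x := a) (y := y))

/-- Pairs of pairings are counted by their decompositions into irreducible pairs. -/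
theorem card_ncPairing_sq (n : ℕ) :
    Nat.card (NCPairing (Fin n)) ^ 2 =
      ∑ π : NC n, ∏ V ∈ π.blocks, Nat.card (IrrPair (Fin V.card)) := by
  classical
  rw [pow_two, ← Nat.card_prod,
    ← Nat.card_eq_of_bijective _ ⟨gluePair_injective (n := n), gluePair_surjective⟩,
    Nat.card_sigma]
  refine Finset.sum_congr rfl fun π _ => ?_
  rw [Nat.card_pi, ← Finset.prod_coe_sort π.blocks]
  exact Finset.prod_congr rfl fun V _ => card_irrPair_congr (π.fiberIso V)

/-! ### Counting non-crossing pairings -/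

theorem card_ncPairing_congr {α : Type*} [LinearOrder α] [Fintype α] {k : ℕ}
    (h : Fintype.card α = k) : Nat.card (NCPairing α) = Nat.card (NCPairing (Fin k)) :=
  Nat.card_congr (NCPairing.congr (Fintype.orderIsoFinOfCardEq α h).symm)

theorem card_ncPairing_zero : Nat.card (NCPairing (Fin 0)) = 1 := by
  rw [Nat.card_eq_one_iff_unique]
  exact ⟨⟨fun f g => NCPairing.ext (funext fun x => x.elim0)⟩,
    ⟨⟨fun x => x, fun x => x.elim0, fun x => x.elim0, fun x => x.elim0⟩⟩⟩

theorem card_ncPairing_two : Nat.card (NCPairing (Fin 2)) = 1 := by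
  rw [Nat.card_eq_one_iff_unique]
  refine ⟨⟨fun f g => NCPairing.ext (funext fun x => ?_)⟩,
    ⟨⟨Fin.rev, Fin.rev_rev, by decide, by decide⟩⟩⟩
  have h1 := f.apply_ne x
  have h2 := g.apply_ne x
  omega

theorem card_ncPairing_odd (m : ℕ) : Nat.card (NCPairing (Fin (2 * m + 1))) = 0 := by
  have : IsEmpty (NCPairing (Fin (2 * m + 1))) := ⟨fun f => by simpa using f.even_card⟩
  exact Nat.card_of_isEmpty

section recursion

variable {n : ℕ} (k : Fin (n + 1))

/-- The arch from `0` to `k + 1` (value `0`), the points under it (value `1`) and the points to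
the right of it (value `2`). -/
def firstArchPart (x : Fin (n + 2)) : Fin 3 :=
  if x = 0 ∨ x = k.succ then 0 else if x < k.succ then 1 else 2

theorem firstArchPart_eq_zero {x : Fin (n + 2)} :
    firstArchPart k x = 0 ↔ x = 0 ∨ x = k.succ := by
  unfold firstArchPart
  split_ifs <;> simp_all

theorem firstArchPart_eq_one {x : Fin (n + 2)} :
    firstArchPart k x = 1 ↔ 0 < x ∧ x < k.succ := by
  unfold firstArchPart
  have := Fin.pos_iff_ne_zero (a := x)
  split_ifs with h1 h2
  · rcases h1 with rfl | rfl <;> simp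
  · simp_all
  · simp_all

theorem firstArchPart_eq_two {x : Fin (n + 2)} :
    firstArchPart k x = 2 ↔ k.succ < x := by
  unfold firstArchPart
  split_ifs with h1 h2
  · rcases h1 with rfl | rfl <;> simp
  · simpa using h2.le
  · push Not at h1 h2
    simpa using lt_of_le_of_ne h2 h1.2.symm

theorem firstArchPart_nonCrossingRel :
    NonCrossingRel fun x y => firstArchPart k x = firstArchPart k y := by
  intro a b c d hab hbc hcd hac hbd
  simp only [firstArchPart, Fin.ext_iff, Fin.lt_def, Fin.val_succ, Fin.val_zero] at *
  split_ifs at * <;> first | rfl | omega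

theorem preserves_firstArchPart_iff (f : NCPairing (Fin (n + 2))) :
    (∀ x, firstArchPart k (f x) = firstArchPart k x) ↔ f 0 = k.succ := by
  constructor
  · intro h
    have h0 := h 0
    rw [(firstArchPart_eq_zero k (x := 0)).2 (Or.inl rfl), firstArchPart_eq_zero] at h0
    exact h0.resolve_left (f.apply_ne 0)
  · intro h x
    have h' : f k.succ = 0 := by rw [← h, f.apply_apply]
    have h1 (y : Fin (n + 2)) : firstArchPart k y = 0 → firstArchPart k (f y) = 0 := by
      simp only [firstArchPart_eq_zero]
      rintro (rfl | rfl)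
      · exact Or.inr h
      · exact Or.inl h'
    have h2 (y : Fin (n + 2)) : firstArchPart k y = 1 → firstArchPart k (f y) = 1 := by
      simp only [firstArchPart_eq_one, ← h]
      exact fun hy => f.lt_apply_of_lt hy.1 hy.2
    have h1' := f.apply_mem_iff h1 x
    have h2' := f.apply_mem_iff h2 x
    omega

theorem card_ncPairing_firstArch :
    Nat.card {f : NCPairing (Fin (n + 2)) // f 0 = k.succ} =
      Nat.card (NCPairing (Fin k)) * Nat.card (NCPairing (Fin (n - k))) := by
  have e := (NCPairing.glueEquiv _ (firstArchPart_nonCrossingRel k)).trans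
    (Equiv.subtypeEquivRight (preserves_firstArchPart_iff k))
  rw [← Nat.card_congr e, Nat.card_pi, Fin.prod_univ_three]
  have c0 : Fintype.card {x // firstArchPart k x = 0} = 2 := by
    rw [Fintype.card_subtype]
    trans ({0, k.succ} : Finset (Fin (n + 2))).card
    · congr 1
      ext x
      simp [firstArchPart_eq_zero]
    · exact Finset.card_pair (Fin.succ_ne_zero k).symm
  have c1 : Fintype.card {x // firstArchPart k x = 1} = k := by
    rw [Fintype.card_subtype]
    trans (Finset.Ioo 0 k.succ).card
    · congr 1
      ext x
      simp [firstArchPart_eq_one]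
    · simp
  have c2 : Fintype.card {x // firstArchPart k x = 2} = n - k := by
    rw [Fintype.card_subtype]
    trans (Finset.Ioi k.succ).card
    · congr 1
      ext x
      simp [firstArchPart_eq_two]
    · simp
  rw [card_ncPairing_congr c0, card_ncPairing_congr c1, card_ncPairing_congr c2,
    card_ncPairing_two, one_mul]

/-- Removing the arch that starts at the first point gives the Catalan recursion. -/
theorem card_ncPairing_add_two (n : ℕ) :
    Nat.card (NCPairing (Fin (n + 2))) =
      ∑ k ∈ Finset.range (n + 1),
        Nat.card (NCPairing (Fin k)) * Nat.card (NCPairing (Fin (n - k))) := by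
  rw [← Nat.card_congr (Equiv.sigmaFiberEquiv
    fun f : NCPairing (Fin (n + 2)) => (f 0).pred (f.apply_ne 0)), Nat.card_sigma,
    Finset.sum_range]
  refine Finset.sum_congr rfl fun k _ => ?_
  rw [← card_ncPairing_firstArch]
  exact Nat.card_congr (Equiv.subtypeEquivRight fun f => Fin.pred_eq_iff_eq_succ (f.apply_ne 0))

end recursion

theorem sum_range_two_mul_add_one {g : ℕ → ℕ} (hg : ∀ i, g (2 * i + 1) = 0) (m : ℕ) :
    ∑ k ∈ Finset.range (2 * m + 1), g k = ∑ i ∈ Finset.range (m + 1), g (2 * i) := by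
  induction m with
  | zero => simp
  | succ m ih =>
    rw [Finset.sum_range_succ _ (m + 1), ← ih, show 2 * (m + 1) + 1 = 2 * m + 1 + 1 + 1 by ring,
      Finset.sum_range_succ, Finset.sum_range_succ _ (2 * m + 1), hg, add_zero]
    rfl

theorem card_ncPairing_even (m : ℕ) : Nat.card (NCPairing (Fin (2 * m))) = catalan m := by
  induction m using Nat.strong_induction_on with
  | _ m ih =>
    cases m with
    | zero => simpa using card_ncPairing_zero
    | succ m =>
      rw [show 2 * (m + 1) = 2 * m + 2 by ring, card_ncPairing_add_two,
        sum_range_two_mul_add_one fun i => by rw [card_ncPairing_odd, zero_mul], catalan_succ,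
        ← Finset.sum_range fun i => catalan i * catalan (m - i)]
      refine Finset.sum_congr rfl fun i hi => ?_
      have hi := Finset.mem_range.1 hi
      rw [ih i (by omega), ← Nat.mul_sub, ih (m - i) (by omega)]

/-! ### The arch diagram of a non-crossing partition -/

section CyclicSucc

variable {n : ℕ} {V : Finset (Fin n)} {i j j' : Fin n}

/-- `j` follows `i` in the cyclic order of `V`: either it is the next larger element, or `i` is the
largest and `j` the smallest element. -/
def IsCyclicSucc (V : Finset (Fin n)) (i j : Fin n) : Prop :=
  (i < j ∧ ∀ k ∈ V, k ≤ i ∨ j ≤ k) ∨ ∀ k ∈ V, j ≤ k ∧ k ≤ i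

theorem IsCyclicSucc.unique (h : IsCyclicSucc V i j) (h' : IsCyclicSucc V i j') (hj : j ∈ V)
    (hj' : j' ∈ V) : j = j' := by
  rcases h with ⟨h1, h2⟩ | h1 <;> rcases h' with ⟨h1', h2'⟩ | h1'
  · have := h2 _ hj'
    have := h2' _ hj
    omega
  · have := h1' _ hj
    omega
  · have := h1 _ hj'
    omega
  · have := h1 _ hj'
    have := h1' _ hj
    omega

theorem isCyclicSucc_increasingCycle (hi : i ∈ V) : IsCyclicSucc V i (increasingCycle V i) := by
  have hmono : StrictMono (V.sort (· ≤ ·)).get := (Finset.sortedLT_sort V).strictMono_get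
  have hmem : ∀ {k}, k ∈ V → ∃ a : Fin (V.sort (· ≤ ·)).length, (V.sort (· ≤ ·)).get a = k :=
    fun hk => List.mem_iff_get.1 ((Finset.mem_sort _).2 hk)
  have happ : ∀ a : Fin (V.sort (· ≤ ·)).length, increasingCycle V ((V.sort (· ≤ ·)).get a) =
      (V.sort (· ≤ ·)).get ⟨(a + 1) % (V.sort (· ≤ ·)).length, Nat.mod_lt _ a.pos⟩ :=
    fun a => List.formPerm_apply_getElem _ (Finset.sort_nodup V _) a a.2
  obtain ⟨a, rfl⟩ := hmem hi
  rw [happ]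
  rcases Nat.lt_or_ge (a + 1) (V.sort (· ≤ ·)).length with h | h
  · refine Or.inl ⟨hmono (Fin.lt_def.2 (by simp only [Nat.mod_eq_of_lt h]; omega)), fun k hk => ?_⟩
    obtain ⟨b, rfl⟩ := hmem hk
    rw [hmono.le_iff_le, hmono.le_iff_le, Fin.le_def, Fin.le_def]
    simp only [Nat.mod_eq_of_lt h]
    omega
  · refine Or.inr fun k hk => ?_
    obtain ⟨b, rfl⟩ := hmem hk
    have ha : (a : ℕ) + 1 = (V.sort (· ≤ ·)).length := le_antisymm a.2 h
    rw [hmono.le_iff_le, hmono.le_iff_le, Fin.le_def, Fin.le_def]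
    simp only [ha, Nat.mod_self]
    omega

end CyclicSucc

variable {n : ℕ}

theorem NC.blockOf_blockPerm (π : NC n) (i : Fin n) : π.blockOf (blockPerm π i) = π.blockOf i :=
  π.blockOf_eq_iff.2 (increasingCycle_mem (π.mem_part_self i))

theorem NC.isCyclicSucc_blockPerm (π : NC n) (i : Fin n) :
    IsCyclicSucc (π.1.part i) i (blockPerm π i) :=
  isCyclicSucc_increasingCycle (π.mem_part_self i)

theorem NC.blockOf_blockPerm_pow (π : NC n) (m : ℕ) (i : Fin n) :
    π.blockOf ((blockPerm π ^ m) i) = π.blockOf i := by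
  induction m with
  | zero => rfl
  | succ m ih => rw [pow_succ', Equiv.Perm.mul_apply, π.blockOf_blockPerm, ih]

theorem NC.increasingCycle_pow_eq (π : NC n) (m : ℕ) (i : Fin n) :
    (increasingCycle (π.1.part i) ^ m) i = (blockPerm π ^ m) i := by
  induction m with
  | zero => rfl
  | succ m ih =>
    have hm : π.1.part ((blockPerm π ^ m) i) = π.1.part i :=
      congrArg Subtype.val (π.blockOf_blockPerm_pow m i)
    rw [pow_succ', pow_succ', Equiv.Perm.mul_apply, Equiv.Perm.mul_apply, ih]
    change _ = increasingCycle (π.1.part _) _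
    rw [hm]

/-- The blocks of `π` are the orbits of its permutation. -/
theorem blockPerm_injective : Function.Injective (blockPerm (n := n)) := by
  have key : ∀ π ρ : NC n, blockPerm π = blockPerm ρ → ∀ x y, π.blockOf x = π.blockOf y →
      ρ.blockOf x = ρ.blockOf y := by
    intro π ρ h x y hxy
    have hc : (increasingCycle (π.1.part y)).IsCycleOn (π.1.part y) := by
      have := (Finset.sort_nodup (π.1.part y) (· ≤ ·)).isCycleOn_formPerm
      simpa [increasingCycle] using this
    obtain ⟨m, -, rfl⟩ :=
      hc.exists_pow_eq (π.mem_part_self y) (π.blockOf_eq_blockOf_iff.1 hxy)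
    rw [π.increasingCycle_pow_eq, h, ρ.blockOf_blockPerm_pow]
  intro π ρ h
  exact NC.ext_of_blockOf fun x y => ⟨key π ρ h x y, key ρ π h.symm x y⟩

/-- Weak inequalities suffice in the definition of a non-crossing partition. -/
theorem NC.blockOf_eq_of_le (π : NC n) {a b c d : Fin n} (hab : a ≤ b) (hbc : b ≤ c) (hcd : c ≤ d)
    (hac : π.blockOf a = π.blockOf c) (hbd : π.blockOf b = π.blockOf d) :
    π.blockOf a = π.blockOf b := by
  rcases hab.eq_or_lt with rfl | hab
  · rfl
  rcases hbc.eq_or_lt with rfl | hbc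
  · exact hac
  rcases hcd.eq_or_lt with rfl | hcd
  · exact hac.trans hbd.symm
  exact π.nonCrossingRel a b c d hab hbc hcd hac hbd

theorem eq_leftPt_or_eq_rightPt (x : Fin (2 * n)) : (∃ i, x = leftPt i) ∨ ∃ i, x = rightPt i := by
  rcases Nat.mod_two_eq_zero_or_one (x : ℕ) with h | h
  · exact Or.inl ⟨halfPt x, by ext; simp [halfPt, leftPt]; omega⟩
  · exact Or.inr ⟨halfPt x, by ext; simp [halfPt, rightPt]; omega⟩

theorem leftPt_injective : Function.Injective (leftPt (n := n)) := by
  intro i j h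
  simp only [leftPt, Fin.ext_iff] at h
  omega

theorem meandricMap_self_cases (π : NC n) (x : Fin (2 * n)) :
    ∃ i, (x = rightPt i ∧ meandricMap π π x = leftPt (blockPerm π i)) ∨
      (x = leftPt (blockPerm π i) ∧ meandricMap π π x = rightPt i) := by
  rcases eq_leftPt_or_eq_rightPt x with ⟨i, rfl⟩ | ⟨i, rfl⟩
  · refine ⟨(blockPerm π).symm i, Or.inr ⟨?_, meandricMap_leftPt π π i⟩⟩
    rw [Equiv.apply_symm_apply]
  · exact ⟨i, Or.inl ⟨rfl, meandricMap_rightPt π π i⟩⟩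

/-- The arch diagram obtained by doubling the points of `π`. The arches join the right copy of `i`
to the left copy of the point following `i` in its block. -/
def archDiagram (π : NC n) : NCPairing (Fin (2 * n)) where
  toFun := meandricMap π π
  apply_apply := meandricMap_comp π π
  apply_ne x h := by
    obtain ⟨i, ⟨h1, h2⟩ | ⟨h1, h2⟩⟩ := meandricMap_self_cases π x <;>
    · rw [h2, h1] at h
      simp only [leftPt, rightPt, Fin.ext_iff] at h
      omega
  not_crossing a b hab hba hlt := by
    obtain ⟨i, hi⟩ := meandricMap_self_cases π a
    obtain ⟨j, hj⟩ := meandricMap_self_cases π b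
    have hi' := π.blockOf_blockPerm i
    have hj' := π.blockOf_blockPerm j
    have hsi := π.isCyclicSucc_blockPerm i
    -- once both arches belong to the same block, the cyclic order of the block forbids a crossing
    have key : π.blockOf j = π.blockOf i → False := by
      intro hij
      have hm := π.blockOf_eq_blockOf_iff.1 hij
      have hm' := π.blockOf_eq_blockOf_iff.1 (hj'.trans hij)
      have h1 : (i < blockPerm π i ∧ (j ≤ i ∨ blockPerm π i ≤ j) ∧
          (blockPerm π j ≤ i ∨ blockPerm π i ≤ blockPerm π j)) ∨
          ((blockPerm π i ≤ j ∧ j ≤ i) ∧ (blockPerm π i ≤ blockPerm π j ∧ blockPerm π j ≤ i)) :=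
        hsi.imp (fun h => ⟨h.1, h.2 _ hm, h.2 _ hm'⟩) (fun h => ⟨h _ hm, h _ hm'⟩)
      rcases hi with ⟨h2, h3⟩ | ⟨h2, h3⟩ <;> rcases hj with ⟨h4, h5⟩ | ⟨h4, h5⟩ <;>
      · rw [h3, h5] at hlt
        rw [h4, h3] at hba
        rw [h2, h4] at hab
        simp only [leftPt, rightPt, Fin.lt_def, Fin.le_def] at hlt hba hab h1
        omega
    rcases hi with ⟨h2, h3⟩ | ⟨h2, h3⟩ <;> rcases hj with ⟨h4, h5⟩ | ⟨h4, h5⟩ <;>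
    · rw [h3, h5] at hlt
      rw [h4, h3] at hba
      rw [h2, h4] at hab
      simp only [leftPt, rightPt, Fin.lt_def] at hlt hba hab
      refine key ?_
      first
      | have := π.blockOf_eq_of_le (a := i) (b := j) (c := blockPerm π i) (d := blockPerm π j)
          (by omega) (by omega) (by omega) hi'.symm hj'.symm
        simp_all
      | have := π.blockOf_eq_of_le (a := i) (b := blockPerm π j) (c := blockPerm π i) (d := j)
          (by omega) (by omega) (by omega) hi'.symm hj'
        simp_all
      | have := π.blockOf_eq_of_le (a := blockPerm π i) (b := j) (c := i) (d := blockPerm π j)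
          (by omega) (by omega) (by omega) hi' hj'.symm
        simp_all
      | have := π.blockOf_eq_of_le (a := blockPerm π i) (b := blockPerm π j) (c := i) (d := j)
          (by omega) (by omega) (by omega) hi' hj'
        simp_all

theorem archDiagram_rightPt (π : NC n) (i : Fin n) :
    archDiagram π (rightPt i) = leftPt (blockPerm π i) := meandricMap_rightPt π π i

theorem archDiagram_injective : Function.Injective (archDiagram (n := n)) := by
  intro π ρ h
  refine blockPerm_injective (Equiv.ext fun i => leftPt_injective ?_)
  rw [← archDiagram_rightPt, ← archDiagram_rightPt, h]

/-- The number of points under an arch is even, because these points are paired. -/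
theorem NCPairing.even_sub_sub_one {m : ℕ} (f : NCPairing (Fin m)) (x : Fin m) :
    Even ((f x : ℕ) - x - 1) := by
  let q : Fin m → Prop := fun y => x < y ∧ y < f x
  have hq : ∀ y, q (f y) = q y :=
    fun y => propext (f.apply_mem_iff (s := q) (fun z hz => f.lt_apply_of_lt hz.1 hz.2) y)
  have h := (f.restrict hq True).even_card
  have hc : Nat.card {y // q y = True} = (Finset.Ioo x (f x)).card := by
    classical
    rw [Nat.card_eq_fintype_card, Fintype.card_subtype]
    congr 1
    ext y
    simp [q]
  rwa [hc, Fin.card_Ioo] at h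

/-- An arch joins a left copy to a right copy, because the number of points under it is even. -/
theorem NCPairing.exists_apply_rightPt (f : NCPairing (Fin (2 * n))) (i : Fin n) :
    ∃ j, f (rightPt i) = leftPt j := by
  rcases eq_leftPt_or_eq_rightPt (f (rightPt i)) with h | ⟨j, h⟩
  · exact h
  exfalso
  rcases lt_trichotomy (rightPt i) (f (rightPt i)) with hlt | heq | hlt
  · have := f.even_sub_sub_one (rightPt i)
    rw [h] at this hlt
    simp only [rightPt, Fin.lt_def] at this hlt
    grind
  · exact f.apply_ne _ heq.symm
  · have := f.even_sub_sub_one (f (rightPt i))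
    rw [f.apply_apply, h] at this
    rw [h] at hlt
    simp only [rightPt, Fin.lt_def] at this hlt
    grind

theorem NCPairing.ext_of_rightPt {f g : NCPairing (Fin (2 * n))}
    (h : ∀ i, f (rightPt i) = g (rightPt i)) : f = g := by
  have hleft : ∀ j, ∃ i, f (rightPt i) = leftPt j := by
    have hinj : Function.Injective fun i => (f.exists_apply_rightPt i).choose := by
      intro i j hij
      have hi := (f.exists_apply_rightPt i).choose_spec
      have hj := (f.exists_apply_rightPt j).choose_spec
      simp only at hij
      rw [← hij, ← hi] at hj
      have := congrArg f hj
      rw [f.apply_apply, f.apply_apply] at this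
      simp only [rightPt, Fin.ext_iff] at this
      omega
    intro j
    obtain ⟨i, rfl⟩ := Finite.surjective_of_injective hinj j
    exact ⟨i, (f.exists_apply_rightPt i).choose_spec⟩
  ext1
  funext x
  rcases eq_leftPt_or_eq_rightPt x with ⟨j, rfl⟩ | ⟨i, rfl⟩
  · obtain ⟨i, hi⟩ := hleft j
    have hi' := hi ▸ h i
    rw [← hi, f.apply_apply, h i, g.apply_apply]
  · exact h i

/-- The two copies of `i` lie on different sides of the gap at `i`. The points `i` and `j` are
equivalent when every arch covers both of these gaps or none of them. -/
def gapSetoid (f : NCPairing (Fin (2 * n))) : Setoid (Fin n) :=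
  Setoid.ker fun i => {x | x ≤ leftPt i ∧ leftPt i < f x}

theorem gapSetoid_iff {f : NCPairing (Fin (2 * n))} {i j : Fin n} :
    gapSetoid f i j ↔ ∀ x, x ≤ leftPt i ∧ leftPt i < f x ↔ x ≤ leftPt j ∧ leftPt j < f x :=
  Set.ext_iff

theorem gapSetoid_nonCrossingRel (f : NCPairing (Fin (2 * n))) : NonCrossingRel (gapSetoid f) := by
  intro a b c d hab hbc hcd hac hbd
  rw [gapSetoid_iff] at *
  intro x
  have h1 := hac x
  have h2 := hbd x
  simp only [leftPt, Fin.lt_def, Fin.le_def] at *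
  omega

theorem isCyclicSucc_gapSetoid (f : NCPairing (Fin (2 * n))) {i j : Fin n}
    (h : f (rightPt i) = leftPt j) {V : Finset (Fin n)} (hV : ∀ k, k ∈ V ↔ gapSetoid f i k) :
    j ∈ V ∧ IsCyclicSucc V i j := by
  have h' : f (leftPt j) = rightPt i := by rw [← h, f.apply_apply]
  -- the only arch ending at one of the two copies is the one joining them
  have hne : ∀ x, (f x = leftPt j → x = rightPt i) ∧ (f x = rightPt i → x = leftPt j) := by
    intro x
    constructor <;> intro hx <;> rw [← f.apply_apply x, hx] <;> assumption
  rcases lt_or_ge i j with hij | hij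
  · have hij' : gapSetoid f i j := by
      rw [gapSetoid_iff]
      intro x
      have h1 := f.lt_apply_of_lt (a := rightPt i) (x := x)
      have h2 := f.lt_apply_of_lt (a := rightPt i) (x := f x)
      have h3 := hne x
      have h4 : x = rightPt i → f x = leftPt j := fun hx => hx ▸ h
      have h5 : x = leftPt j → f x = rightPt i := fun hx => hx ▸ h'
      rw [f.apply_apply] at h2
      rw [h] at h1 h2
      simp only [leftPt, rightPt, Fin.lt_def, Fin.le_def, Fin.ext_iff] at *
      omega
    refine ⟨(hV j).2 hij', Or.inl ⟨hij, fun k hk => ?_⟩⟩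
    have := gapSetoid_iff.1 ((hV k).1 hk) (rightPt i)
    rw [h] at this
    simp only [leftPt, rightPt, Fin.lt_def, Fin.le_def] at *
    omega
  · have hij' : gapSetoid f i j := by
      rw [gapSetoid_iff]
      intro x
      have h1 := f.lt_apply_of_lt (a := leftPt j) (x := x)
      have h2 := f.lt_apply_of_lt (a := leftPt j) (x := f x)
      have h3 := hne x
      have h4 : x = rightPt i → f x = leftPt j := fun hx => hx ▸ h
      have h5 : x = leftPt j → f x = rightPt i := fun hx => hx ▸ h'
      rw [f.apply_apply] at h2
      rw [h'] at h1 h2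
      simp only [leftPt, rightPt, Fin.lt_def, Fin.le_def, Fin.ext_iff] at *
      omega
    refine ⟨(hV j).2 hij', Or.inr fun k hk => ?_⟩
    have := gapSetoid_iff.1 ((hV k).1 hk) (leftPt j)
    rw [h'] at this
    simp only [leftPt, rightPt, Fin.lt_def, Fin.le_def] at *
    omega

theorem archDiagram_surjective : Function.Surjective (archDiagram (n := n)) := by
  intro f
  refine ⟨NC.ofSetoid (gapSetoid f) (gapSetoid_nonCrossingRel f),
    NCPairing.ext_of_rightPt fun i => ?_⟩
  set π := NC.ofSetoid (gapSetoid f) (gapSetoid_nonCrossingRel f)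
  obtain ⟨j, hj⟩ := f.exists_apply_rightPt i
  obtain ⟨hjV, hs⟩ := isCyclicSucc_gapSetoid f hj (V := π.1.part i) fun k => by
    rw [← π.blockOf_eq_blockOf_iff, eq_comm]
    exact NC.blockOf_ofSetoid
  rw [archDiagram_rightPt, hj, (π.isCyclicSucc_blockPerm i).unique hs
    (π.blockOf_eq_blockOf_iff.1 (π.blockOf_blockPerm i)) hjV]

/-- An interval is stable under a meandric system when it is stable under both arch diagrams. The
meandric system acts as the first diagram on left points and as the second on right points, and
its inverse does the opposite. -/
theorem mapsTo_meandricSystem_iff (π ρ : NC n) (S : Set (Fin (2 * n))) :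
    Set.MapsTo (meandricSystem π ρ) S S ↔
      Set.MapsTo (archDiagram π) S S ∧ Set.MapsTo (archDiagram ρ) S S := by
  constructor
  · intro h
    have hinv : Set.MapsTo (meandricMap ρ π) S S := Equiv.Perm.perm_symm_mapsTo_of_mapsTo _ h
    change Set.MapsTo (meandricMap π ρ) S S at h
    constructor <;> intro x hx <;>
      rcases eq_leftPt_or_eq_rightPt x with ⟨i, rfl⟩ | ⟨i, rfl⟩
    · have := h hx
      rwa [meandricMap_leftPt, ← meandricMap_leftPt π π] at this
    · have := hinv hx
      rwa [meandricMap_rightPt, ← meandricMap_rightPt π π] at this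
    · have := hinv hx
      rwa [meandricMap_leftPt, ← meandricMap_leftPt ρ ρ] at this
    · have := h hx
      rwa [meandricMap_rightPt, ← meandricMap_rightPt ρ ρ] at this
  · rintro ⟨h1, h2⟩ x hx
    change meandricMap π ρ x ∈ S
    rcases eq_leftPt_or_eq_rightPt x with ⟨i, rfl⟩ | ⟨i, rfl⟩
    · rw [meandricMap_leftPt, ← meandricMap_leftPt π π]
      exact h1 hx
    · rw [meandricMap_rightPt, ← meandricMap_rightPt ρ ρ]
      exact h2 hx

theorem isIrreducible_meandricSystem_iff (π ρ : NC n) :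
    IsIrreducible (meandricSystem π ρ) ↔ IsIrreduciblePair (archDiagram π, archDiagram ρ) := by
  simp only [IsIrreducible, IsReducible, IsIrreduciblePair, mapsTo_meandricSystem_iff]
  push Not
  exact ⟨fun h a b hab h1 h2 => by_contra fun hne => h a b hab hne h1 h2,
    fun h a b hab hne h1 h2 => hne (h a b hab h1 h2)⟩

theorem numIrreducible_eq (n : ℕ) : numIrreducible n = Nat.card (IrrPair (Fin (2 * n))) := by
  let e : NC n ≃ NCPairing (Fin (2 * n)) :=
    Equiv.ofBijective archDiagram ⟨archDiagram_injective, archDiagram_surjective⟩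
  exact Nat.card_congr ((e.prodCongr e).subtypeEquiv fun p =>
    isIrreducible_meandricSystem_iff p.1 p.2)

theorem card_irrPair_odd (m : ℕ) : Nat.card (IrrPair (Fin (2 * m + 1))) = 0 := by
  have : IsEmpty (IrrPair (Fin (2 * m + 1))) := ⟨fun p => by simpa using p.1.1.even_card⟩
  exact Nat.card_of_isEmpty

/-! ### Moments of the semicircle law -/

open Real in
theorem semicircle_integral_eq (n : ℕ) :
    ∫ t in (-2 : ℝ)..2, t ^ n * √(4 - t ^ 2) =
      2 ^ (n + 2) * ((∫ x in (0 : ℝ)..π, cos x ^ n) - ∫ x in (0 : ℝ)..π, cos x ^ (n + 2)) := by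
  have h := intervalIntegral.integral_comp_mul_deriv (a := π) (b := 0) (f := fun x => 2 * cos x)
    (f' := fun x => 2 * -sin x) (g := fun t => t ^ n * √(4 - t ^ 2))
    (fun x _ => (hasDerivAt_cos x).const_mul 2) (by fun_prop) (by fun_prop)
  simp only [cos_pi, cos_zero, mul_neg, mul_one] at h
  rw [← h, intervalIntegral.integral_symm, ← intervalIntegral.integral_neg,
    ← intervalIntegral.integral_sub ((by fun_prop : Continuous _).intervalIntegrable _ _)
      ((by fun_prop : Continuous _).intervalIntegrable _ _),
    ← intervalIntegral.integral_const_mul]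
  refine intervalIntegral.integral_congr fun x hx => ?_
  rw [Set.uIcc_of_le pi_pos.le] at hx
  have hs := sin_nonneg_of_mem_Icc hx
  have h4 : (4 : ℝ) - (2 * cos x) ^ 2 = (2 * sin x) ^ 2 := by
    have := sin_sq_add_cos_sq x
    linear_combination (-4 : ℝ) * this
  simp only [Function.comp_apply]
  rw [h4, sqrt_sq (by positivity)]
  have : cos x ^ (n + 2) = cos x ^ n * (1 - sin x ^ 2) := by rw [pow_add, cos_sq']
  rw [this]
  ring

open Real in
theorem integral_cos_pow_zero_pi_add_two (n : ℕ) :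
    (n + 2) * ∫ x in (0 : ℝ)..π, cos x ^ (n + 2) = (n + 1) * ∫ x in (0 : ℝ)..π, cos x ^ n := by
  rw [integral_cos_pow]
  simp only [sin_pi, sin_zero]
  field_simp
  ring

open Real in
theorem integral_cos_pow_zero_pi_odd (m : ℕ) : ∫ x in (0 : ℝ)..π, cos x ^ (2 * m + 1) = 0 := by
  induction m with
  | zero => simp
  | succ m ih =>
    have h := integral_cos_pow_zero_pi_add_two (2 * m + 1)
    rw [ih, mul_zero] at h
    exact (mul_eq_zero.1 h).resolve_left (by positivity)

open Real in
theorem integral_cos_pow_zero_pi_even (m : ℕ) :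
    2 ^ (2 * m) * ∫ x in (0 : ℝ)..π, cos x ^ (2 * m) = π * m.centralBinom := by
  induction m with
  | zero => simp
  | succ m ih =>
    have h := integral_cos_pow_zero_pi_add_two (2 * m)
    have hc : ((m : ℝ) + 1) * (m + 1).centralBinom = 2 * (2 * m + 1) * m.centralBinom := by
      exact_mod_cast Nat.succ_mul_centralBinom_succ m
    have hm : ((m : ℝ) + 1) ≠ 0 := by positivity
    apply mul_left_cancel₀ hm
    rw [show 2 * (m + 1) = 2 * m + 2 by ring, pow_add]
    push_cast at h
    linear_combination (2 * 2 ^ (2 * m) : ℝ) * h + (2 * (2 * m + 1) : ℝ) * ih - π * hc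

theorem semicircle_moment_odd (m : ℕ) :
    (2 * Real.pi)⁻¹ * ∫ t in (-2 : ℝ)..2, t ^ (2 * m + 1) * √(4 - t ^ 2) = 0 := by
  rw [semicircle_integral_eq, integral_cos_pow_zero_pi_odd,
    show 2 * m + 1 + 2 = 2 * (m + 1) + 1 by ring, integral_cos_pow_zero_pi_odd]
  simp

theorem semicircle_moment_even (m : ℕ) :
    (2 * Real.pi)⁻¹ * ∫ t in (-2 : ℝ)..2, t ^ (2 * m) * √(4 - t ^ 2) = catalan m := by
  have h := integral_cos_pow_zero_pi_add_two (2 * m)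
  have h0 := integral_cos_pow_zero_pi_even m
  have hc : ((m : ℝ) + 1) * catalan m = m.centralBinom := by
    exact_mod_cast succ_mul_catalan_eq_centralBinom m
  have hm : ((m : ℝ) + 1) ≠ 0 := by positivity
  rw [semicircle_integral_eq, inv_mul_eq_iff_eq_mul₀ (by positivity)]
  apply mul_left_cancel₀ hm
  push_cast at h
  rw [pow_add]
  linear_combination (-2 * 2 ^ (2 * m) : ℝ) * h + 2 * h0 - 2 * Real.pi * hc

/-! ### The product of two independent semicircular variables -/

theorem IsCentredSemicircular.moment_eq_card {Ω : Type*} [MeasurableSpace Ω] {P : Measure Ω}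
    {ξ : Ω → ℝ} (h : IsCentredSemicircular P ξ) (n : ℕ) :
    ∫ ω, ξ ω ^ n ∂P = Nat.card (NCPairing (Fin n)) := by
  rw [h.moment]
  obtain ⟨m, rfl | rfl⟩ := n.even_or_odd'
  · rw [semicircle_moment_even, card_ncPairing_even]
  · rw [semicircle_moment_odd, card_ncPairing_odd, Nat.cast_zero]

variable {Ω : Type*} [MeasurableSpace Ω] {P : Measure Ω} {ξ η : Ω → ℝ}

theorem IsCentredSemicircular.integrable_mul_pow (hξ : IsCentredSemicircular P ξ)
    (hη : IsCentredSemicircular P η) (hind : IndepFun ξ η P) (n : ℕ) :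
    Integrable (fun ω => (ξ ω * η ω) ^ n) P := by
  simp only [mul_pow]
  exact (hind.comp (measurable_id.pow_const n) (measurable_id.pow_const n)).integrable_mul
    (hξ.integrable_pow n) (hη.integrable_pow n)

theorem IsCentredSemicircular.integral_mul_pow (hξ : IsCentredSemicircular P ξ)
    (hη : IsCentredSemicircular P η) (hind : IndepFun ξ η P) (n : ℕ) :
    ∫ ω, (ξ ω * η ω) ^ n ∂P = (Nat.card (NCPairing (Fin n)) : ℝ) ^ 2 := by
  simp only [mul_pow]
  rw [pow_two, ← hξ.moment_eq_card]
  nth_rewrite 2 [hξ.moment_eq_card]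
  rw [← hη.moment_eq_card]
  exact (hind.comp (measurable_id.pow_const n)
    (measurable_id.pow_const n)).integral_mul_eq_mul_integral
    (hξ.integrable_pow n).aestronglyMeasurable (hη.integrable_pow n).aestronglyMeasurable

theorem freeCumulant_mul_eq_card (hξ : IsCentredSemicircular P ξ)
    (hη : IsCentredSemicircular P η) (hind : IndepFun ξ η P) {n : ℕ} (hn : 1 ≤ n) :
    freeCumulant (distribution P fun ω => ξ ω * η ω) n = Nat.card (IrrPair (Fin n)) := by
  symm
  refine eq_freeCumulant _ (fun n => (Nat.card (IrrPair (Fin n)) : ℂ)) (fun n _ => ?_) n hn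
  rw [distribution_X_pow, hξ.integral_mul_pow hη hind]
  exact_mod_cast card_ncPairing_sq n

end Meandric

theorem theorem1p2 {Ω : Type*} [MeasurableSpace Ω] (P : Measure Ω) [IsProbabilityMeasure P]
    (ξ η : Ω → ℝ) (hξ : Meandric.IsCentredSemicircular P ξ)
    (hη : Meandric.IsCentredSemicircular P η) (hind : IndepFun ξ η P) :
    (∀ n : ℕ, Integrable (fun ω => (ξ ω * η ω) ^ n) P) ∧
    (∀ n : ℕ, 1 ≤ n →
      Meandric.freeCumulant (Meandric.distribution P (fun ω => ξ ω * η ω)) (2 * n - 1) = 0 ∧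
      Meandric.freeCumulant (Meandric.distribution P (fun ω => ξ ω * η ω)) (2 * n) =
        (Meandric.numIrreducible n : ℂ)) ∧
    Meandric.rTransform (Meandric.distribution P (fun ω => ξ ω * η ω)) =
      Meandric.irreducibleSeries := by
  have hodd (m : ℕ) :
      Meandric.freeCumulant (Meandric.distribution P (fun ω => ξ ω * η ω)) (2 * m + 1) = 0 := by
    rw [Meandric.freeCumulant_mul_eq_card hξ hη hind (by omega), Meandric.card_irrPair_odd,
      Nat.cast_zero]
  have heven (n : ℕ) (hn : 1 ≤ n) :
      Meandric.freeCumulant (Meandric.distribution P (fun ω => ξ ω * η ω)) (2 * n) =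
        (Meandric.numIrreducible n : ℂ) := by
    rw [Meandric.freeCumulant_mul_eq_card hξ hη hind (by omega), Meandric.numIrreducible_eq]
  refine ⟨hξ.integrable_mul_pow hη hind, fun n hn => ⟨?_, heven n hn⟩, ?_⟩
  · obtain ⟨m, rfl⟩ := Nat.exists_eq_add_of_le' hn
    exact hodd m
  · ext k
    simp only [Meandric.rTransform, Meandric.irreducibleSeries, PowerSeries.coeff_mk]
    rcases Nat.eq_zero_or_pos k with rfl | hk
    · simp
    obtain ⟨m, rfl | rfl⟩ := k.even_or_odd'
    · rw [if_neg hk.ne', if_pos ⟨even_two_mul m, hk.ne'⟩, heven m (by omega),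
        Nat.mul_div_cancel_left m two_pos]
    · rw [if_neg hk.ne', if_neg (by simp), hodd]
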